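/- For a partition $\pi=(\pi_1\ge\dots\ge\pi_{\ell(\pi)}\ge 1)$ of $n$ with $\ell(\pi)$ parts, and $\lambda\vdash n$, let $\chi^{\lambda}_{\pi}$ be the value, on the permutations of cycle type $\pi$, of the character of the irreducible complex representation of the symmetric group $\mathfrak S_n$ indexed by $\lambda$ (the Specht module of shape $\lambda$, normalized so that $(n)$ gives the trivial representation). For $0\le k\le n-1$ let $\{n|k\}=(n-k,1^k)$ be the hook partition of $n$ with first part $n-k$ followed by $k$ parts equal to $1$. Then for every $n$, every partition $\pi\vdash n$ and every integer $j$ with $0\le j\le \ell(\pi)-1$, $$\sum_{k=0}^{n-1}(-1)^k\,\chi_{\pi}^{\{n|k\}}\,(n-2k-1)^j=\begin{cases}2^{\ell(\pi)-1}\,(\ell(\pi)-1)!\,\displaystyle\prod_{i=1}^{\ell(\pi)}\pi_i,&\text{if } j=\ell(\pi)-1,\\[4pt] 0,&\text{if } 0\le j\le \ell(\pi)-2,\end{cases}$$ where $0^0=1$. -/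

import Mathlib

open scoped Nat MonoidAlgebra

noncomputable section

namespace SymmetricGroupCharacter

/-- The Young diagram of a partition `lam` of `n`: its `i`-th row has `lam_i` cells, the parts
being listed in weakly decreasing order. -/
def diagram {n : ℕ} (lam : n.Partition) : YoungDiagram :=
  YoungDiagram.ofRowLens (lam.parts.sort (· ≥ ·)) (lam.parts.pairwise_sort (· ≥ ·)).sortedGE

theorem card_cellsOfRowLens (w : List ℕ) : (YoungDiagram.cellsOfRowLens w).card = w.sum := by
  induction w with
  | nil => simp [YoungDiagram.cellsOfRowLens]
  | cons a w ih =>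
    rw [YoungDiagram.cellsOfRowLens, Finset.card_union_of_disjoint]
    · simp [ih]
    · rw [Finset.disjoint_left]
      rintro ⟨i, j⟩ h1 h2
      simp only [Finset.mem_product, Finset.mem_singleton] at h1
      simp only [Finset.mem_map, Prod.exists] at h2
      obtain ⟨x, y, -, h⟩ := h2
      have h' := congrArg Prod.fst h
      simp [h1.1] at h'

theorem card_diagram {n : ℕ} (lam : n.Partition) : (diagram lam).cells.card = n := by
  have h : (diagram lam).cells = YoungDiagram.cellsOfRowLens (lam.parts.sort (· ≥ ·)) := rfl
  rw [h, card_cellsOfRowLens, ← Multiset.sum_coe, Multiset.sort_eq, lam.parts_sum]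

/-- A Young tableau of shape `lam` (every cell filled with one of the `n` symbols `0, …, n - 1`,
each used once), recorded as the map sending a symbol to the cell that contains it. -/
abbrev Tableau {n : ℕ} (lam : n.Partition) : Type :=
  Fin n ≃ {c : ℕ × ℕ // c ∈ (diagram lam).cells}

theorem nonempty_tableau {n : ℕ} (lam : n.Partition) : Nonempty (Tableau lam) :=
  ⟨Fintype.equivOfCardEq (by simp [card_diagram])⟩

/-- The row stabilizer of a tableau: the permutations of the symbols that keep every symbol in its
row. -/
def rowGroup {n : ℕ} {lam : n.Partition} (T : Tableau lam) : Finset (Equiv.Perm (Fin n)) :=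
  Finset.univ.filter fun g => ∀ i, (T (g i)).1.1 = (T i).1.1

/-- The column stabilizer of a tableau: the permutations of the symbols that keep every symbol in
its column. -/
def colGroup {n : ℕ} {lam : n.Partition} (T : Tableau lam) : Finset (Equiv.Perm (Fin n)) :=
  Finset.univ.filter fun g => ∀ i, (T (g i)).1.2 = (T i).1.2

/-- The Young symmetrizer `c_T = a_T b_T` in `ℂ[𝔖_n]`, with `a_T` the sum of the row stabilizer
and `b_T` the signed sum of the column stabilizer. -/
def youngSymmetrizer {n : ℕ} {lam : n.Partition} (T : Tableau lam) : ℂ[Equiv.Perm (Fin n)] :=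
  (∑ p ∈ rowGroup T, MonoidAlgebra.single p (1 : ℂ)) *
    ∑ q ∈ colGroup T, MonoidAlgebra.single q (((Equiv.Perm.sign q : ℤ) : ℂ))

/-- The Specht module of a tableau `T`: the left ideal `ℂ[𝔖_n] c_T`. -/
abbrev spechtModule {n : ℕ} {lam : n.Partition} (T : Tableau lam) :
    Ideal ℂ[Equiv.Perm (Fin n)] :=
  Ideal.span {youngSymmetrizer T}

/-- The representation of `𝔖_n` on the Specht module by left multiplication. -/
def spechtRep {n : ℕ} {lam : n.Partition} (T : Tableau lam) :
    Representation ℂ (Equiv.Perm (Fin n)) (spechtModule T) :=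
  Representation.ofModule' (spechtModule T)

theorem spechtRep_apply {n : ℕ} {lam : n.Partition} (T : Tableau lam) (g : Equiv.Perm (Fin n))
    (x : spechtModule T) :
    ((spechtRep T g x : spechtModule T) : ℂ[Equiv.Perm (Fin n)]) =
      MonoidAlgebra.single g (1 : ℂ) * x := by
  simp [spechtRep, Representation.ofModule', MonoidAlgebra.lift]

/-- The character of the irreducible representation of `𝔖_n` indexed by `lam`, that is, of the
Specht module of a tableau of shape `lam`. It does not depend on the tableau:
see `irrCharacter_eq`. In this labelling the one-row partition `(n)` gives the trivial
representation and the one-column partition `(1^n)` the sign representation. -/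
def irrCharacter {n : ℕ} (lam : n.Partition) (g : Equiv.Perm (Fin n)) : ℂ :=
  (spechtRep (nonempty_tableau lam).some).character g

/-- `g` has cycle type `π`, fixed points counting as cycles of length one. -/
def HasCycleType {n : ℕ} (g : Equiv.Perm (Fin n)) (π : n.Partition) : Prop :=
  g.partition.parts = π.parts

theorem exists_hasCycleType {n : ℕ} (π : n.Partition) :
    ∃ g : Equiv.Perm (Fin n), HasCycleType g π := by
  have hsum : (π.parts.filter (2 ≤ ·)).sum + (π.parts.filter (¬ 2 ≤ ·)).sum = n := by
    rw [← Multiset.sum_add, Multiset.filter_add_not, π.parts_sum]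
  obtain ⟨g, hg⟩ := (Equiv.Perm.exists_with_cycleType_iff (α := Fin n)
    (m := π.parts.filter (2 ≤ ·))).2
    ⟨by rw [Fintype.card_fin]; omega, fun a ha => (Multiset.mem_filter.1 ha).2⟩
  refine ⟨g, ?_⟩
  have hrep : π.parts.filter (¬ 2 ≤ ·) =
      Multiset.replicate (π.parts.filter (¬ 2 ≤ ·)).card 1 := by
    refine Multiset.eq_replicate_card.2 fun b hb => ?_
    obtain ⟨hb1, hb2⟩ := Multiset.mem_filter.1 hb
    have := π.parts_pos hb1
    omega
  have hcard : (π.parts.filter (¬ 2 ≤ ·)).sum = (π.parts.filter (¬ 2 ≤ ·)).card := by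
    conv_lhs => rw [hrep]
    simp
  rw [HasCycleType, Equiv.Perm.parts_partition, ← Equiv.Perm.sum_cycleType, hg,
    ← Multiset.filter_add_not (2 ≤ ·) π.parts]
  congr 1
  · rw [Multiset.filter_add_not]
  · rw [Multiset.filter_add_not, hrep]
    congr 1
    rw [Fintype.card_fin]
    omega

/-- `chi lam π` is `χ^lam_π`, the value of the irreducible character indexed by `lam` on the
permutations of cycle type `π`. It does not depend on the permutation: see `chi_eq`. -/
def chi {n : ℕ} (lam π : n.Partition) : ℂ :=
  irrCharacter lam (exists_hasCycleType π).choose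

theorem chi_eq {n : ℕ} (lam π : n.Partition) (g : Equiv.Perm (Fin n)) (hg : HasCycleType g π) :
    chi lam π = irrCharacter lam g := by
  have h : (exists_hasCycleType π).choose.partition.parts = g.partition.parts :=
    (exists_hasCycleType π).choose_spec.trans hg.symm
  obtain ⟨c, hc⟩ := isConj_iff.1
    (Equiv.Perm.partition_eq_of_isConj.2 (Nat.Partition.ext h))
  rw [chi, irrCharacter, irrCharacter, ← hc, Representation.char_conj]

theorem youngSymmetrizer_relabel {n : ℕ} {lam : n.Partition} (T : Tableau lam)
    (t : Equiv.Perm (Fin n)) :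
    MonoidAlgebra.single t (1 : ℂ) * youngSymmetrizer (t.trans T : Tableau lam) =
      youngSymmetrizer T * MonoidAlgebra.single t (1 : ℂ) := by
  have hrow : MonoidAlgebra.single t (1 : ℂ) *
        ∑ p ∈ rowGroup (t.trans T : Tableau lam), MonoidAlgebra.single p (1 : ℂ) =
      (∑ p ∈ rowGroup T, MonoidAlgebra.single p (1 : ℂ)) * MonoidAlgebra.single t (1 : ℂ) := by
    rw [Finset.mul_sum, Finset.sum_mul]
    refine Finset.sum_bij' (fun p _ => t * p * t⁻¹) (fun p _ => t⁻¹ * p * t) ?_ ?_ ?_ ?_ ?_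
    · intro p hp
      simp only [rowGroup, Finset.mem_filter, Finset.mem_univ, true_and] at hp ⊢
      intro i
      simpa using hp (t⁻¹ i)
    · intro p hp
      simp only [rowGroup, Finset.mem_filter, Finset.mem_univ, true_and] at hp ⊢
      intro i
      simpa using hp (t i)
    · intro p _; group
    · intro p _; group
    · intro p _; simp [MonoidAlgebra.single_mul_single]
  have hcol : MonoidAlgebra.single t (1 : ℂ) *
        ∑ q ∈ colGroup (t.trans T : Tableau lam),
          MonoidAlgebra.single q (((Equiv.Perm.sign q : ℤ) : ℂ)) =
      (∑ q ∈ colGroup T, MonoidAlgebra.single q (((Equiv.Perm.sign q : ℤ) : ℂ))) *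
        MonoidAlgebra.single t (1 : ℂ) := by
    rw [Finset.mul_sum, Finset.sum_mul]
    refine Finset.sum_bij' (fun p _ => t * p * t⁻¹) (fun p _ => t⁻¹ * p * t) ?_ ?_ ?_ ?_ ?_
    · intro p hp
      simp only [colGroup, Finset.mem_filter, Finset.mem_univ, true_and] at hp ⊢
      intro i
      simpa using hp (t⁻¹ i)
    · intro p hp
      simp only [colGroup, Finset.mem_filter, Finset.mem_univ, true_and] at hp ⊢
      intro i
      simpa using hp (t i)
    · intro p _; group
    · intro p _; group
    · intro p _
      simp [MonoidAlgebra.single_mul_single, mul_comm, ← mul_assoc]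
  rw [youngSymmetrizer, youngSymmetrizer, ← mul_assoc, hrow, mul_assoc, hcol, mul_assoc]

theorem mem_spechtModule {n : ℕ} {lam : n.Partition} (T : Tableau lam)
    (x : ℂ[Equiv.Perm (Fin n)]) :
    x ∈ spechtModule T ↔ ∃ a, a * youngSymmetrizer T = x := by
  rw [spechtModule, Ideal.mem_span_singleton']

theorem mul_single_mem {n : ℕ} {lam : n.Partition} (T T' : Tableau lam)
    (x : ℂ[Equiv.Perm (Fin n)]) (hx : x ∈ spechtModule T) :
    x * MonoidAlgebra.single (T'.trans T.symm : Equiv.Perm (Fin n)) (1 : ℂ) ∈ spechtModule T' := by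
  obtain ⟨a, rfl⟩ := (mem_spechtModule T x).1 hx
  have hT : ((T'.trans T.symm : Equiv.Perm (Fin n)).trans T : Tableau lam) = T' := by
    ext i <;> simp
  have h := youngSymmetrizer_relabel T (T'.trans T.symm : Equiv.Perm (Fin n))
  rw [hT] at h
  refine (mem_spechtModule T' _).2
    ⟨a * MonoidAlgebra.single (T'.trans T.symm : Equiv.Perm (Fin n)) (1 : ℂ), ?_⟩
  rw [mul_assoc, h, mul_assoc]

/-- Right multiplication by the relabelling permutation identifies the Specht modules of two
tableaux of the same shape. -/
def spechtEquiv {n : ℕ} {lam : n.Partition} (T T' : Tableau lam) :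
    spechtModule T ≃ₗ[ℂ] spechtModule T' where
  toFun x := ⟨x.1 * MonoidAlgebra.single (T'.trans T.symm : Equiv.Perm (Fin n)) (1 : ℂ),
    mul_single_mem T T' x.1 x.2⟩
  invFun x := ⟨x.1 * MonoidAlgebra.single (T.trans T'.symm : Equiv.Perm (Fin n)) (1 : ℂ),
    mul_single_mem T' T x.1 x.2⟩
  map_add' x y := Subtype.ext (add_mul _ _ _)
  map_smul' c x := Subtype.ext (smul_mul_assoc c (x.1 : ℂ[Equiv.Perm (Fin n)]) _)
  left_inv x := Subtype.ext (by
    have h : (T'.trans T.symm : Equiv.Perm (Fin n)) * (T.trans T'.symm : Equiv.Perm (Fin n)) = 1 := by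
      ext i; simp
    simp [mul_assoc, MonoidAlgebra.single_mul_single, h, ← MonoidAlgebra.one_def])
  right_inv x := Subtype.ext (by
    have h : (T.trans T'.symm : Equiv.Perm (Fin n)) * (T'.trans T.symm : Equiv.Perm (Fin n)) = 1 := by
      ext i; simp
    simp [mul_assoc, MonoidAlgebra.single_mul_single, h, ← MonoidAlgebra.one_def])

theorem irrCharacter_eq {n : ℕ} {lam : n.Partition} (T : Tableau lam) (g : Equiv.Perm (Fin n)) :
    irrCharacter lam g = (spechtRep T).character g := by
  have h : spechtRep T g =
      (spechtEquiv (nonempty_tableau lam).some T).conj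
        (spechtRep (nonempty_tableau lam).some g) := by
    refine LinearMap.ext fun x => ?_
    obtain ⟨y, rfl⟩ := (spechtEquiv (nonempty_tableau lam).some T).surjective x
    rw [LinearEquiv.conj_apply_apply, LinearEquiv.symm_apply_apply]
    apply Subtype.ext
    rw [spechtRep_apply]
    simp only [spechtEquiv, LinearEquiv.coe_mk, LinearMap.coe_mk, AddHom.coe_mk]
    rw [spechtRep_apply, mul_assoc]
  rw [irrCharacter, Representation.character, Representation.character, h, LinearMap.trace_conj']

/-- The hook partition `{n|k} = (n - k, 1^k)` of `n`, for `0 ≤ k ≤ n - 1`. -/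
def hook (n : ℕ) (k : Fin n) : n.Partition where
  parts := (n - (k : ℕ)) ::ₘ Multiset.replicate (k : ℕ) 1
  parts_pos := by
    intro i hi
    have hk := k.isLt
    rcases Multiset.mem_cons.1 hi with h | h
    · omega
    · rw [Multiset.eq_of_mem_replicate h]
      exact Nat.one_pos
  parts_sum := by
    have hk := k.isLt
    simp only [Multiset.sum_cons, Multiset.sum_replicate, smul_eq_mul, mul_one]
    omega

end SymmetricGroupCharacter

end

noncomputable section

namespace HookCharacter

open Equiv Equiv.Perm

variable {n k : ℕ}

/-! ### Counting permutations by their values on an injective tuple -/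

/-! The heart is a generating function: for `g` of cycle type π, `(1 - X) * ∑ (-1)^k χ^{n|k}(g) X^k
= ∏ (1 - X^{π_i})` (`one_sub_X_mul_sum_hook`). Cancelling one factor, the alternating polynomial is
`(1 - X)^(ℓ - 1)` times `∏ (1 + X + ⋯ + X^(π_i - 1))`. Pairing `X^k` with `f k` turns multiplication
by `1 - X` into minus the forward difference of `f`. So the weighted sum takes the `(ℓ - 1)`-st
difference of `(n - 1 - 2x)^j`: it is zero for `j < ℓ - 1`, and for `j = ℓ - 1` it is the constant
`(-2)^(ℓ - 1) (ℓ - 1)!`, which multiplies the value `∏ π_i` of the second factor at 1.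

Conceptually, the `(k + 1)`-st exterior power of the permutation representation is the sum of two
consecutive hook representations, and its trace is a coefficient of `det (1 + X P_g)`. Here this is
reached by computing with Young symmetrizers. The hook symmetrizer satisfies `c * c = α • c`
(`hookElement_mul_self`), so `α` times its character is the trace of `x ↦ g x c` on the group
algebra (`smul_trace_span_singleton`). That trace is a sum of bordered determinants of `P_g`
(`irrCharacter_hook`), and Laplace expansion ties consecutive sums to principal minors
(`borderedSum_succ`). Finally `det (1 + q P_g)` factors over the cycles of `g`. -/

theorem card_perm_comp_eq {m : ℕ} (β : Fin m ↪ Fin n) (y : Fin m → Fin n)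
    (hy : Function.Injective y) :
    (Finset.univ.filter fun h : Perm (Fin n) => ⇑h ∘ β = y).card = (n - m)! := by
  classical
  obtain ⟨e, he⟩ : ∃ e : Perm (Fin n), ⇑e ∘ β = y := by
    refine ⟨((Equiv.ofInjective β β.injective).symm.trans
      (Equiv.ofInjective y hy)).extendSubtype, ?_⟩
    funext i
    rw [Function.comp_apply, Equiv.extendSubtype_apply_of_mem _ _ ⟨i, rfl⟩]
    simp
  -- Left translation by `e⁻¹` carries the fibre over `y` to the pointwise stabilizer of the range
  -- of `β`.
  have h1 : (Finset.univ.filter fun h : Perm (Fin n) => ⇑h ∘ β = y).card =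
      Fintype.card {h : Perm (Fin n) // ∀ a, ¬ (a ∉ Set.range β) → h a = a} := by
    rw [Fintype.card_subtype]
    refine Finset.card_bij' (fun h _ => e⁻¹ * h) (fun h _ => e * h) ?_ ?_ ?_ ?_
    · intro h hh
      simp only [Finset.mem_filter, Finset.mem_univ, true_and, not_not] at hh ⊢
      rintro _ ⟨i, rfl⟩
      have := congrFun (hh.trans he.symm) i
      simp only [Function.comp_apply] at this
      simp [this]
    · intro h hh
      simp only [Finset.mem_filter, Finset.mem_univ, true_and, not_not] at hh ⊢
      rw [← he]
      funext i
      simp [hh (β i) ⟨i, rfl⟩]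
    · intro h _; simp
    · intro h _; simp
  rw [h1, ← Fintype.card_congr (Equiv.Perm.subtypeEquivSubtypePerm fun a => a ∉ Set.range β),
    Fintype.card_perm]
  congr 1
  rw [Fintype.card_subtype_compl, Fintype.card_fin]
  congr 1
  rw [← Fintype.card_congr (Equiv.ofInjective β β.injective), Fintype.card_fin]

/-- As `h` runs over the permutations, `h ∘ β` meets each injective tuple `(n - m)!` times; the
vanishing of `H` elsewhere lets the sum run freely over all tuples. -/
theorem sum_perm_comp {M : Type*} [AddCommMonoid M] {m : ℕ} (β : Fin m ↪ Fin n)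
    (H : (Fin m → Fin n) → M) (hH : ∀ y, ¬ Function.Injective y → H y = 0) :
    ∑ h : Perm (Fin n), H (⇑h ∘ β) = (n - m)! • ∑ y, H y := by
  classical
  rw [← Finset.sum_fiberwise Finset.univ (fun h : Perm (Fin n) => ⇑h ∘ β), Finset.smul_sum]
  refine Finset.sum_congr rfl fun y _ => ?_
  rw [Finset.sum_congr rfl (g := fun _ => H y)
    (fun h hh => by rw [(Finset.mem_filter.1 hh).2]), Finset.sum_const]
  by_cases hy : Function.Injective y
  · rw [card_perm_comp_eq β y hy]
  · rw [hH y hy, smul_zero, smul_zero]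

theorem eq_zero_of_eq_neg {M : Type*} [AddCommGroup M] [Module ℂ M] {x : M} (h : x = -x) :
    x = 0 := by
  have h2 : (2 : ℂ) • x = 0 := by
    rw [two_smul]
    nth_rewrite 2 [h]
    exact add_neg_cancel x
  exact (smul_eq_zero.1 h2).resolve_left two_ne_zero

/-! ### The antisymmetrizer of a tuple and the Garnir relation -/

theorem viaFintypeEmbedding_mul {m : ℕ} (β : Fin m ↪ Fin n) (σ τ : Perm (Fin m)) :
    (σ * τ).viaFintypeEmbedding β = σ.viaFintypeEmbedding β * τ.viaFintypeEmbedding β :=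
  (Equiv.Perm.extendDomain_mul _ _ _).symm

/-- The signed sum of the permutations of the entries of an injective tuple. -/
def antisymmetrizer {m : ℕ} (β : Fin m ↪ Fin n) : ℂ[Perm (Fin n)] :=
  ∑ σ : Perm (Fin m), MonoidAlgebra.single (σ.viaFintypeEmbedding β) (((sign σ : ℤ) : ℂ))

theorem single_mul_antisymmetrizer {m : ℕ} (β : Fin m ↪ Fin n) (τ : Perm (Fin m)) :
    MonoidAlgebra.single (τ.viaFintypeEmbedding β) (1 : ℂ) * antisymmetrizer β =
      ((sign τ : ℤ) : ℂ) • antisymmetrizer β := by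
  rw [antisymmetrizer, Finset.mul_sum, Finset.smul_sum]
  refine Fintype.sum_equiv (Equiv.mulLeft τ) _ _ fun σ => ?_
  rw [MonoidAlgebra.single_mul_single, Equiv.coe_mulLeft, viaFintypeEmbedding_mul,
    MonoidAlgebra.smul_single, one_mul, Equiv.Perm.sign_mul]
  rcases Int.units_eq_one_or (sign τ) with h | h <;> simp [h]

/-- The sum of the permutations that send the tuple `b` to the tuple `t`. -/
def cosetSum (b t : Fin k → Fin n) : ℂ[Perm (Fin n)] :=
  ∑ h : Perm (Fin n), if ⇑h ∘ b = t then MonoidAlgebra.single h (1 : ℂ) else 0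

theorem single_mul_cosetSum (b t : Fin k → Fin n) (g : Perm (Fin n)) :
    MonoidAlgebra.single g (1 : ℂ) * cosetSum b t = cosetSum b (g ∘ t) := by
  rw [cosetSum, cosetSum, Finset.mul_sum]
  refine Fintype.sum_equiv (Equiv.mulLeft g) _ _ fun h => ?_
  have : ⇑(g * h) ∘ b = ⇑g ∘ t ↔ ⇑h ∘ b = t := by
    rw [Equiv.Perm.coe_mul, Function.comp_assoc]
    exact g.injective.comp_left.eq_iff
  simp only [Equiv.coe_mulLeft, this, mul_ite, mul_zero, MonoidAlgebra.single_mul_single,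
    one_mul]

/-- The tail of a tuple. -/
abbrev tail (β : Fin (k + 1) ↪ Fin n) : Fin k → Fin n := fun i => β i.succ

/-- The translate of the hook symmetrizer indexed by a tuple. -/
def hookElement (β : Fin (k + 1) ↪ Fin n) (t : Fin k → Fin n) : ℂ[Perm (Fin n)] :=
  cosetSum (tail β) t * antisymmetrizer β

theorem single_mul_hookElement (β : Fin (k + 1) ↪ Fin n) (t : Fin k → Fin n)
    (g : Perm (Fin n)) :
    MonoidAlgebra.single g (1 : ℂ) * hookElement β t = hookElement β (g ∘ t) := by
  rw [hookElement, ← mul_assoc, single_mul_cosetSum, hookElement]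

/-- Reordering `t` is right multiplication of the coset sum by a permutation of the column that
fixes its corner `β 0`; the antisymmetrizer absorbs it with its sign. -/
theorem hookElement_comp_perm (β : Fin (k + 1) ↪ Fin n) (t : Fin k → Fin n)
    (e : Perm (Fin k)) :
    hookElement β (t ∘ e) = ((sign e : ℤ) : ℂ) • hookElement β t := by
  set τ : Perm (Fin (k + 1)) := decomposeFin.symm (0, e) with hτ
  have hsign : sign τ = sign e := by rw [hτ, decomposeFin.symm_sign]; simp
  have hact : ⇑(τ.viaFintypeEmbedding β) ∘ tail β = tail β ∘ e := by
    funext i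
    simp [tail, viaFintypeEmbedding_apply_image, hτ]
  have hcoset : cosetSum (tail β) (t ∘ e) =
      cosetSum (tail β) t * MonoidAlgebra.single (τ.viaFintypeEmbedding β) (1 : ℂ) := by
    rw [cosetSum, cosetSum, Finset.sum_mul]
    refine (Fintype.sum_equiv (Equiv.mulRight (τ.viaFintypeEmbedding β)) _ _ fun h => ?_).symm
    have : ⇑(h * τ.viaFintypeEmbedding β) ∘ tail β = t ∘ e ↔ ⇑h ∘ tail β = t := by
      rw [Equiv.Perm.coe_mul, Function.comp_assoc, hact, ← Function.comp_assoc]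
      exact e.surjective.injective_comp_right.eq_iff
    simp only [Equiv.coe_mulRight, this, ite_mul, zero_mul, MonoidAlgebra.single_mul_single,
      one_mul]
  rw [hookElement, hcoset, mul_assoc, single_mul_antisymmetrizer, hsign, mul_smul_comm,
    hookElement]

/-- The Garnir relation. Summing over `x` drops the condition on the image of `β l.succ`, so the
coset sum becomes invariant under right multiplication by the transposition of `β 0` and `β l.succ`,
whereas the antisymmetrizer changes sign. -/
theorem sum_hookElement_update (β : Fin (k + 1) ↪ Fin n) (t : Fin k → Fin n) (l : Fin k) :
    ∑ x, hookElement β (Function.update t l x) = 0 := by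
  set τ : Perm (Fin (k + 1)) := Equiv.swap 0 l.succ with hτ
  set A : ℂ[Perm (Fin n)] := ∑ h : Perm (Fin n),
    if ∀ i, i ≠ l → h (tail β i) = t i then MonoidAlgebra.single h (1 : ℂ) else 0 with hA
  have h1 : ∑ x, cosetSum (tail β) (Function.update t l x) = A := by
    simp only [cosetSum]
    rw [Finset.sum_comm, hA]
    refine Finset.sum_congr rfl fun h _ => ?_
    have hiff : ∀ x, ⇑h ∘ tail β = Function.update t l x ↔
        x = h (tail β l) ∧ ∀ i, i ≠ l → h (tail β i) = t i := by
      intro x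
      rw [Function.eq_update_iff]
      simp only [Function.comp_apply]
      tauto
    simp only [hiff, ite_and]
    simp
  have h2 : A * MonoidAlgebra.single (τ.viaFintypeEmbedding β) (1 : ℂ) = A := by
    rw [hA, Finset.sum_mul]
    refine Fintype.sum_equiv (Equiv.mulRight (τ.viaFintypeEmbedding β)) _ _ fun h => ?_
    have : (∀ i, i ≠ l → (h * τ.viaFintypeEmbedding β) (tail β i) = t i) ↔
        ∀ i, i ≠ l → h (tail β i) = t i := by
      refine forall₂_congr fun i hi => ?_
      have : τ i.succ = i.succ :=
        Equiv.swap_apply_of_ne_of_ne (Fin.succ_ne_zero i) (by simpa using hi)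
      rw [Equiv.Perm.mul_apply, tail, viaFintypeEmbedding_apply_image, this]
    simp only [Equiv.coe_mulRight, this, ite_mul, zero_mul, MonoidAlgebra.single_mul_single,
      one_mul]
  have h3 : A * antisymmetrizer β = -(A * antisymmetrizer β) := by
    conv_lhs => rw [← h2, mul_assoc, single_mul_antisymmetrizer, hτ,
      sign_swap (Fin.succ_ne_zero l).symm]
    simp
  simp only [hookElement]
  rw [← Finset.sum_mul, h1]
  exact eq_zero_of_eq_neg h3

/-! ### The hook symmetrizer is a quasi-idempotent -/

/-- The alternating sum over all ways of permuting a `(k + 1)`-tuple and dropping its first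
entry. -/
def alternatingSum (β : Fin (k + 1) ↪ Fin n) (y : Fin (k + 1) → Fin n) : ℂ[Perm (Fin n)] :=
  ∑ σ : Perm (Fin (k + 1)), ((sign σ : ℤ) : ℂ) • hookElement β fun i => y (σ i.succ)

theorem alternatingSum_eq_zero (β : Fin (k + 1) ↪ Fin n) (y : Fin (k + 1) → Fin n)
    (hy : ¬ Function.Injective y) : alternatingSum β y = 0 := by
  obtain ⟨i, j, hij, hne⟩ : ∃ i j, y i = y j ∧ i ≠ j := by
    simpa [Function.Injective] using hy
  have hswap : ∀ x, y (Equiv.swap i j x) = y x := fun x => by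
    rcases eq_or_ne x i with rfl | h1
    · simp [hij]
    rcases eq_or_ne x j with rfl | h2
    · simp [hij]
    rw [Equiv.swap_apply_of_ne_of_ne h1 h2]
  have : alternatingSum β y = -alternatingSum β y := by
    conv_lhs => rw [alternatingSum]
    rw [alternatingSum, ← Finset.sum_neg_distrib]
    refine Fintype.sum_equiv (Equiv.mulLeft (Equiv.swap i j)) _ _ fun σ => ?_
    simp [sign_swap hne, hswap]
  exact eq_zero_of_eq_neg this

/-- Split by whether `σ` fixes 0. If it does, `x` is dropped and the two signs cancel, giving
`hookElement β t` for each of the `n * k !` pairs. If not, `x` occupies one position of the tuple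
and the Garnir relation kills the sum over `x`. -/
theorem sum_alternatingSum_cons (β : Fin (k + 1) ↪ Fin n) (t : Fin k → Fin n) :
    ∑ x, alternatingSum β (Fin.cons x t) = (n * k ! : ℂ) • hookElement β t := by
  simp only [alternatingSum]
  rw [Finset.sum_comm, ← Equiv.sum_comp (decomposeFin (n := k)).symm, Fintype.sum_prod_type,
    Fin.sum_univ_succ]
  have h0 : ∑ p : Fin k, ∑ e : Perm (Fin k), ∑ x : Fin n,
      ((sign (decomposeFin.symm (p.succ, e)) : ℤ) : ℂ) •
        hookElement β (fun i => (Fin.cons x t : Fin (k + 1) → Fin n)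
          (decomposeFin.symm (p.succ, e) i.succ)) = 0 := by
    refine Finset.sum_eq_zero fun p _ => Finset.sum_eq_zero fun e _ => ?_
    rw [← Finset.smul_sum]
    set σ := decomposeFin.symm (p.succ, e) with hσ
    have hne : σ.symm 0 ≠ 0 := by
      rw [Ne, Equiv.symm_apply_eq]
      simp [hσ, Fin.succ_ne_zero, eq_comm]
    obtain ⟨l, hl⟩ := Fin.exists_succ_eq.2 hne
    have hl' : σ l.succ = 0 := by rw [hl]; simp
    -- Only position `l` sees `x`; the dummy `x'` makes the base tuple of the update independent of
    -- the summation variable.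
    have hz : ∀ x x' : Fin n,
        (fun i : Fin k => (Fin.cons x t : Fin (k + 1) → Fin n) (σ i.succ)) =
        Function.update (fun i => (Fin.cons x' t : Fin (k + 1) → Fin n) (σ i.succ)) l x := by
      intro x x'
      rw [Function.eq_update_iff]
      refine ⟨by simp [hl'], fun i hi => ?_⟩
      have : σ i.succ ≠ 0 := by
        rw [← hl']
        simpa using hi
      obtain ⟨m, hm⟩ := Fin.exists_succ_eq.2 this
      simp [← hm]
    rcases isEmpty_or_nonempty (Fin n) with hn | ⟨⟨x'⟩⟩
    · simp
    · rw [Finset.sum_congr rfl fun x _ => by rw [hz x x'], sum_hookElement_update, smul_zero]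
  rw [h0, add_zero]
  have h1 : ∀ e : Perm (Fin k), ∀ x : Fin n,
      ((sign (decomposeFin.symm (0, e)) : ℤ) : ℂ) •
        hookElement β (fun i => (Fin.cons x t : Fin (k + 1) → Fin n)
          (decomposeFin.symm (0, e) i.succ)) = hookElement β t := by
    intro e x
    have : (fun i : Fin k => (Fin.cons x t : Fin (k + 1) → Fin n)
        (decomposeFin.symm (0, e) i.succ)) = t ∘ e := by
      funext i
      simp
    rw [this, hookElement_comp_perm, decomposeFin.symm_sign, smul_smul]
    rcases Int.units_eq_one_or (sign e) with h | h <;> simp [h]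
  simp only [h1, Finset.sum_const, Finset.card_univ, Fintype.card_fin, Fintype.card_perm]
  rw [← Nat.cast_smul_eq_nsmul ℂ, ← Nat.cast_smul_eq_nsmul ℂ, smul_smul, mul_comm]

/-- Expanding the left factor gives alternating sums at the tuples `p ∘ β` with `p` fixing the tail.
They vanish on tuples with repetitions, so the corner entry may range over all of `Fin n`, which
produces the factor `n`. -/
theorem hookElement_mul_self (β : Fin (k + 1) ↪ Fin n) :
    hookElement β (tail β) * hookElement β (tail β) =
      ((n - (k + 1))! * (n * k !) : ℂ) • hookElement β (tail β) := by
  have h1 : ∀ p : Perm (Fin n), MonoidAlgebra.single p (1 : ℂ) *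
      (antisymmetrizer β * hookElement β (tail β)) = alternatingSum β (p ∘ β) := by
    intro p
    rw [antisymmetrizer, Finset.sum_mul, Finset.mul_sum, alternatingSum]
    refine Finset.sum_congr rfl fun σ _ => ?_
    have : MonoidAlgebra.single (σ.viaFintypeEmbedding β) ((sign σ : ℤ) : ℂ) =
        ((sign σ : ℤ) : ℂ) • MonoidAlgebra.single (σ.viaFintypeEmbedding β) (1 : ℂ) := by
      simp [MonoidAlgebra.smul_single]
    rw [this, smul_mul_assoc, mul_smul_comm, single_mul_hookElement, single_mul_hookElement]
    congr 2
    funext i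
    simp [tail, viaFintypeEmbedding_apply_image]
  have h2 : hookElement β (tail β) * hookElement β (tail β) =
      ∑ p : Perm (Fin n), (fun y : Fin (k + 1) → Fin n =>
        if (fun i : Fin k => y i.succ) = tail β then alternatingSum β y else 0) (p ∘ β) := by
    nth_rewrite 1 [hookElement]
    rw [mul_assoc, cosetSum, Finset.sum_mul]
    refine Finset.sum_congr rfl fun p _ => ?_
    rw [ite_mul, zero_mul, h1]
    rfl
  rw [h2, sum_perm_comp β (fun y : Fin (k + 1) → Fin n =>
    if (fun i : Fin k => y i.succ) = tail β then alternatingSum β y else 0)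
    fun y hy => by simp [alternatingSum_eq_zero β y hy]]
  rw [← Equiv.sum_comp (Fin.consEquiv fun _ => Fin n), Fintype.sum_prod_type]
  have h3 : ∀ x : Fin n, (∑ y : Fin k → Fin n,
      if (fun i : Fin k => (Fin.consEquiv fun _ => Fin n) (x, y) i.succ) = tail β then
        alternatingSum β ((Fin.consEquiv fun _ => Fin n) (x, y)) else 0) =
      alternatingSum β (Fin.cons x (tail β)) := by
    intro x
    simp [Fin.consEquiv]
  simp only [h3]
  rw [sum_alternatingSum_cons, ← Nat.cast_smul_eq_nsmul ℂ, smul_smul]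

/-! ### Traces on left ideals generated by quasi-idempotents -/

theorem trace_monoidAlgebra (f : ℂ[Perm (Fin n)] →ₗ[ℂ] ℂ[Perm (Fin n)]) :
    LinearMap.trace ℂ _ f =
      ∑ h : Perm (Fin n), (f (MonoidAlgebra.single h 1)).coeff h := by
  classical
  rw [LinearMap.trace_eq_matrix_trace ℂ (MonoidAlgebra.basis (Perm (Fin n)) ℂ), Matrix.trace]
  refine Finset.sum_congr rfl fun h _ => ?_
  rw [Matrix.diag_apply, LinearMap.toMatrix_apply]
  simp [MonoidAlgebra.basis]

/-- Right multiplication by `c` maps the algebra into the ideal and is the scalar `α` on the ideal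
itself. Cyclicity of the trace then moves the computation to the whole group algebra, where the
permutations form a basis. -/
theorem smul_trace_span_singleton (c : ℂ[Perm (Fin n)]) (α : ℂ) (hc : c * c = α • c)
    (g : Perm (Fin n))
    (f : (Ideal.span {c} : Ideal ℂ[Perm (Fin n)]) →ₗ[ℂ]
      (Ideal.span {c} : Ideal ℂ[Perm (Fin n)]))
    (hf : ∀ x, (f x : ℂ[Perm (Fin n)]) = MonoidAlgebra.single g (1 : ℂ) * x) :
    α * LinearMap.trace ℂ _ f =
      ∑ h : Perm (Fin n), (MonoidAlgebra.single (g * h) (1 : ℂ) * c).coeff h := by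
  let i : (Ideal.span {c} : Ideal ℂ[Perm (Fin n)]) →ₗ[ℂ] ℂ[Perm (Fin n)] :=
    (Ideal.span {c} : Ideal ℂ[Perm (Fin n)]).subtype.restrictScalars ℂ
  let p : ℂ[Perm (Fin n)] →ₗ[ℂ] (Ideal.span {c} : Ideal ℂ[Perm (Fin n)]) :=
    { toFun := fun x => ⟨x * c, Ideal.mul_mem_left _ _ (Ideal.mem_span_singleton_self c)⟩
      map_add' := fun x y => Subtype.ext (add_mul _ _ _)
      map_smul' := fun r x => Subtype.ext (smul_mul_assoc _ _ _) }
  have hpi : (f ∘ₗ p) ∘ₗ i = α • f := by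
    refine LinearMap.ext fun x => Subtype.ext ?_
    obtain ⟨a, ha⟩ := Ideal.mem_span_singleton'.1 x.2
    have hx : (x : ℂ[Perm (Fin n)]) * c = α • x := by
      rw [← ha, mul_assoc, hc, mul_smul_comm]
    change (f (p x) : ℂ[Perm (Fin n)]) = α • (f x : ℂ[Perm (Fin n)])
    rw [hf, hf]
    change MonoidAlgebra.single g (1 : ℂ) * (x * c) = _
    rw [hx, mul_smul_comm]
  have : Module.Finite ℂ ℂ[Perm (Fin n)] :=
    Module.Finite.of_basis (MonoidAlgebra.basis (Perm (Fin n)) ℂ)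
  have : Module.Finite ℂ (Ideal.span {c} : Ideal ℂ[Perm (Fin n)]) :=
    Module.Finite.of_injective i Subtype.val_injective
  rw [← smul_eq_mul, ← map_smul, ← hpi, ← LinearMap.trace_comp_comm', trace_monoidAlgebra]
  refine Finset.sum_congr rfl fun h _ => ?_
  change ((f (p (MonoidAlgebra.single h 1)) : ℂ[Perm (Fin n)])).coeff h = _
  rw [hf]
  change (MonoidAlgebra.single g (1 : ℂ) * (MonoidAlgebra.single h 1 * c)).coeff h = _
  rw [← mul_assoc, MonoidAlgebra.single_mul_single, one_mul]

end HookCharacter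

namespace HookCharacter

open Equiv Equiv.Perm

/-! ### Bordered determinants -/

/-- The square matrix `(a (x m) (x l))` with its first column replaced by ones. -/
def borderedMatrix {n k : ℕ} (a : Matrix (Fin n) (Fin n) ℂ) (x : Fin (k + 1) → Fin n) :
    Matrix (Fin (k + 1)) (Fin (k + 1)) ℂ :=
  Matrix.of fun m => Fin.cons 1 fun l => a (x m) (x l.succ)

theorem det_borderedMatrix_eq_zero {n k : ℕ} (a : Matrix (Fin n) (Fin n) ℂ)
    (x : Fin (k + 1) → Fin n) (hx : ¬ Function.Injective x) : (borderedMatrix a x).det = 0 := by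
  obtain ⟨i, j, hij, hne⟩ : ∃ i j, x i = x j ∧ i ≠ j := by
    simpa [Function.Injective] using hx
  refine Matrix.det_zero_of_row_eq hne ?_
  funext l
  simp only [borderedMatrix, Matrix.of_apply, hij]

theorem det_submatrix_eq_zero {n k : ℕ} (a : Matrix (Fin n) (Fin n) ℂ)
    (x : Fin k → Fin n) (hx : ¬ Function.Injective x) : (a.submatrix x x).det = 0 := by
  obtain ⟨i, j, hij, hne⟩ : ∃ i j, x i = x j ∧ i ≠ j := by
    simpa [Function.Injective] using hx
  refine Matrix.det_zero_of_row_eq hne ?_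
  funext l
  simp [hij]

/-- The sum of the bordered determinants over all tuples. -/
def borderedSum {n : ℕ} (a : Matrix (Fin n) (Fin n) ℂ) (k : ℕ) : ℂ :=
  ∑ x : Fin (k + 1) → Fin n, (borderedMatrix a x).det

theorem borderedSum_zero {n : ℕ} (a : Matrix (Fin n) (Fin n) ℂ) : borderedSum a 0 = n := by
  simp [borderedSum, borderedMatrix]

theorem borderedSum_eq_zero {n k : ℕ} (a : Matrix (Fin n) (Fin n) ℂ) (h : n ≤ k) :
    borderedSum a k = 0 := by
  refine Finset.sum_eq_zero fun x _ => det_borderedMatrix_eq_zero a x fun hx => ?_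
  have := Fintype.card_le_of_injective x hx
  simp at this
  omega

/-- Expand along the first row and sum over its index `y`. The corner 1 contributes `n` copies of a
principal minor; every other entry sums to a column sum, namely 1, and leaves a smaller bordered
determinant with its rows cycled. -/
theorem borderedSum_succ {n k : ℕ} (a : Matrix (Fin n) (Fin n) ℂ)
    (ha : ∀ z, ∑ y, a y z = 1) :
    borderedSum a (k + 1) + (k + 1) * borderedSum a k =
      n * ∑ x : Fin (k + 1) → Fin n, (a.submatrix x x).det := by
  have hminor : ∀ (y : Fin n) (t : Fin (k + 1) → Fin n) (l : Fin (k + 1)),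
      ((borderedMatrix a (Fin.cons y t : Fin (k + 2) → Fin n)).submatrix Fin.succ
        (l.succ.succAbove)).det = (-1) ^ (l : ℕ) *
          (borderedMatrix a (t ∘ l.cycleRange.symm)).det := by
    intro y t l
    -- Moving entry `l` of `t` to the front makes its column the one replaced by ones, at the cost
    -- of the sign of a cycle.
    have h1 : borderedMatrix a (t ∘ l.cycleRange.symm) =
        ((borderedMatrix a (Fin.cons y t : Fin (k + 2) → Fin n)).submatrix Fin.succ
          (l.succ.succAbove)).submatrix l.cycleRange.symm id := by
      ext i j
      refine Fin.cases ?_ (fun j => ?_) j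
      · simp [borderedMatrix]
      · simp [borderedMatrix, Fin.succ_succAbove_succ]
    rw [h1, Matrix.det_permute, ← mul_assoc]
    simp [Fin.sign_cycleRange, ← mul_pow]
  have hzero : ∀ (y : Fin n) (t : Fin (k + 1) → Fin n),
      (borderedMatrix a (Fin.cons y t : Fin (k + 2) → Fin n)).submatrix Fin.succ
        (Fin.succAbove 0) = a.submatrix t t := by
    intro y t
    ext i j
    simp [borderedMatrix]
  have h2 : borderedSum a (k + 1) = ∑ t : Fin (k + 1) → Fin n,
      ((n : ℂ) * (a.submatrix t t).det -
        ∑ l : Fin (k + 1), (borderedMatrix a (t ∘ l.cycleRange.symm)).det) := by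
    rw [borderedSum, ← Equiv.sum_comp (Fin.consEquiv fun _ => Fin n), Fintype.sum_prod_type,
      Finset.sum_comm]
    refine Finset.sum_congr rfl fun t _ => ?_
    simp only [Fin.consEquiv, Equiv.coe_fn_mk]
    have hexp := fun y : Fin n =>
      Matrix.det_succ_row_zero (borderedMatrix a (Fin.cons y t : Fin (k + 2) → Fin n))
    simp only [hexp]
    rw [Finset.sum_comm, Fin.sum_univ_succ]
    simp only [hzero, hminor]
    rw [sub_eq_add_neg, ← Finset.sum_neg_distrib]
    congr 1
    · simp [borderedMatrix]
    · refine Finset.sum_congr rfl fun l _ => ?_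
      have h3 : ∀ y : Fin n, borderedMatrix a (Fin.cons y t : Fin (k + 2) → Fin n) 0 l.succ =
          a y (t l) := fun y => by simp [borderedMatrix]
      simp only [h3]
      rw [← Finset.sum_mul, ← Finset.mul_sum, ha, Fin.val_succ, pow_succ]
      rcases neg_one_pow_eq_or ℂ (l : ℕ) with h | h <;> simp [h]
  rw [h2, Finset.sum_sub_distrib, ← Finset.mul_sum, Finset.sum_comm]
  have h4 : ∀ l : Fin (k + 1), ∑ t : Fin (k + 1) → Fin n,
      (borderedMatrix a (t ∘ l.cycleRange.symm)).det = borderedSum a k := fun l =>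
    Equiv.sum_comp (Equiv.arrowCongr l.cycleRange (Equiv.refl (Fin n)))
      fun x => (borderedMatrix a x).det
  simp [h4]

/-- Each principal minor of size `k` arises from the `k !` enumerations of its index set, and tuples
with repetitions contribute nothing. -/
theorem sum_det_submatrix {n : ℕ} (a : Matrix (Fin n) (Fin n) ℂ) (k : ℕ) :
    ∑ x : Fin k → Fin n, (a.submatrix x x).det =
      k ! * (1 + (Polynomial.X : Polynomial ℂ) • a.map Polynomial.C).det.coeff k := by
  classical
  rw [Matrix.coeff_det_one_add_X_smul_eq_sum_minors, Finset.mul_sum]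
  have h1 : ∀ s ∈ Finset.powersetCard k (Finset.univ : Finset (Fin n)),
      (k ! : ℂ) * (a.submatrix (Subtype.val : s → Fin n) Subtype.val).det =
        ∑ e : Fin k ≃ s, (a.submatrix (fun i => (e i : Fin n)) fun i => (e i : Fin n)).det := by
    intro s hs
    have hcard : Fintype.card s = k := by
      rw [Fintype.card_coe]
      exact (Finset.mem_powersetCard.1 hs).2
    have h2 : ∀ e : Fin k ≃ s,
        (a.submatrix (fun i => (e i : Fin n)) fun i => (e i : Fin n)).det =
          (a.submatrix (Subtype.val : s → Fin n) Subtype.val).det := fun e =>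
      Matrix.det_submatrix_equiv_self e (a.submatrix (Subtype.val : s → Fin n) Subtype.val)
    simp only [h2, Finset.sum_const, Finset.card_univ]
    rw [Fintype.card_equiv (Fintype.equivOfCardEq (by simp [hcard])), Fintype.card_fin,
      nsmul_eq_mul]
  rw [Finset.sum_congr rfl h1, Finset.sum_sigma',
    ← Finset.sum_filter_of_ne (p := Function.Injective)
      fun x _ hx => by_contra fun h => hx (det_submatrix_eq_zero a x h)]
  symm
  refine Finset.sum_bij (fun p _ => fun i => (p.2 i : Fin n)) ?_ ?_ ?_ ?_
  · rintro ⟨s, e⟩ _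
    exact Finset.mem_filter.2
      ⟨Finset.mem_univ _, Subtype.val_injective.comp e.injective⟩
  · rintro ⟨s, e⟩ _ ⟨s', e'⟩ _ h
    have hrange : ∀ (s : Finset (Fin n)) (e : Fin k ≃ s) (y : Fin n),
        y ∈ s ↔ ∃ i, (e i : Fin n) = y := fun s e y =>
      ⟨fun hy => ⟨e.symm ⟨y, hy⟩, by simp⟩, fun ⟨i, hi⟩ => hi ▸ (e i).2⟩
    have hs : s = s' := by
      ext y
      rw [hrange s e, hrange s' e']
      exact exists_congr fun i => by rw [congrFun h i]
    subst hs
    congr 1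
    ext i
    exact congrArg Fin.val (congrFun h i)
  · intro x hx
    have hx' : Function.Injective x := (Finset.mem_filter.1 hx).2
    refine ⟨⟨Finset.univ.image x, (Equiv.ofInjective x hx').trans
      (Equiv.subtypeEquivRight fun y => by simp)⟩, ?_, ?_⟩
    · simp [Finset.mem_powersetCard, Finset.card_image_of_injective _ hx']
    · funext i
      simp
  · intro _ _
    rfl

/-! ### The characteristic polynomial of a permutation matrix -/

section PermutationMatrix

variable {α R : Type*} [Fintype α] [DecidableEq α] [CommRing R]

/-- The matrix of the linear map permuting the standard basis by `σ`. -/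
def permutationMatrix (R : Type*) [CommRing R] (σ : Perm α) : Matrix α α R :=
  Matrix.of fun i j => if i = σ j then 1 else 0

theorem sum_permutationMatrix (σ : Perm α) (j : α) : ∑ i, permutationMatrix R σ i j = 1 := by
  simp [permutationMatrix]

omit [Fintype α] in
theorem permutationMatrix_one : permutationMatrix R (1 : Perm α) = 1 := by
  ext i j
  simp only [permutationMatrix, Matrix.of_apply, Matrix.one_apply]
  rfl

theorem permutationMatrix_mul (σ τ : Perm α) :
    permutationMatrix R (σ * τ) = permutationMatrix R σ * permutationMatrix R τ := by
  ext i j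
  simp only [permutationMatrix, Matrix.of_apply, Matrix.mul_apply, mul_ite, mul_one, mul_zero,
    Finset.sum_ite_eq', Finset.mem_univ, if_true]
  rfl

omit [Fintype α] in
-- At each point one of the two permutations is the identity and the other agrees with the product.
theorem permutationMatrix_add_of_disjoint {σ τ : Perm α} (h : σ.Disjoint τ) :
    permutationMatrix R σ + permutationMatrix R τ = 1 + permutationMatrix R (σ * τ) := by
  ext i j
  rcases h j with hj | hj
  · have : σ (τ j) = τ j := by
      rcases h (τ j) with h1 | h1
      · exact h1
      · rw [τ.injective h1, hj]
    simp [permutationMatrix, Matrix.one_apply, hj, this]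
  · simp [permutationMatrix, Matrix.one_apply, hj, add_comm]

/-- If `τ` agrees with `σ` at a moved point, injectivity forbids it to fix the next point of the
orbit, so the agreement propagates around the cycle. -/
theorem eq_one_or_eq_of_isCycle {σ τ : Perm α} (hσ : σ.IsCycle)
    (h : ∀ i, τ i = i ∨ τ i = σ i) : τ = 1 ∨ τ = σ := by
  by_cases hτ : τ = 1
  · exact Or.inl hτ
  right
  obtain ⟨x, hx⟩ : ∃ x, τ x ≠ x := by
    by_contra hcon
    push Not at hcon
    exact hτ (Equiv.ext hcon)
  have hx' : τ x = σ x := (h x).resolve_left hx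
  have hpow : ∀ m : ℕ, τ ((σ ^ m) x) = σ ((σ ^ m) x) := by
    intro m
    induction m with
    | zero => simpa using hx'
    | succ m ih =>
      rw [pow_succ', Equiv.Perm.mul_apply]
      refine (h _).resolve_left fun hfix => ?_
      have h1 : σ ((σ ^ m) x) = (σ ^ m) x := τ.injective (by rw [hfix, ih])
      have h2 : σ x = x := by
        apply (σ ^ m).injective
        rw [← Equiv.Perm.mul_apply, ← pow_succ, pow_succ', Equiv.Perm.mul_apply, h1]
      exact hx (hx'.trans h2)
  ext y
  by_cases hy : σ y = y
  · rcases h y with h1 | h1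
    · rw [h1, hy]
    · exact h1
  · obtain ⟨m, rfl⟩ := hσ.exists_pow_eq (hx' ▸ hx) hy
    exact hpow m

/-- In the Leibniz expansion only the identity and `σ` avoid a zero entry. -/
theorem det_one_add_smul_permutationMatrix_of_isCycle {σ : Perm α} (hσ : σ.IsCycle) (q : R) :
    (1 + q • permutationMatrix R σ).det =
      (1 + q) ^ (Fintype.card α - σ.support.card) * (1 - (-q) ^ σ.support.card) := by
  have hcard : (Finset.univ.filter fun i => ¬ i ∈ σ.support).card =
      Fintype.card α - σ.support.card := by
    rw [Finset.filter_not, Finset.filter_mem_eq_inter, Finset.univ_inter,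
      Finset.card_sdiff_of_subset (Finset.subset_univ _), Finset.card_univ]
  have hprod : ∀ (f : α → R) (u v : R), (∀ i ∈ σ.support, f i = u) →
      (∀ i ∉ σ.support, f i = v) →
      ∏ i, f i = v ^ (Fintype.card α - σ.support.card) * u ^ σ.support.card := by
    intro f u v hu hv
    rw [← Finset.prod_filter_mul_prod_filter_not Finset.univ (· ∈ σ.support),
      Finset.prod_congr rfl (g := fun _ => u) fun i hi => hu i (Finset.mem_filter.1 hi).2,
      Finset.prod_congr rfl (g := fun _ => v) fun i hi => hv i (Finset.mem_filter.1 hi).2,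
      Finset.prod_const, Finset.prod_const, hcard, Finset.filter_mem_eq_inter,
      Finset.univ_inter, mul_comm]
  rw [Matrix.det_apply', ← Finset.sum_subset (Finset.subset_univ {1, σ}),
    Finset.sum_pair hσ.ne_one.symm, hprod _ 1 (1 + q), hprod _ q (1 + q), hσ.sign]
  · rw [neg_pow q, Equiv.Perm.sign_one]
    push_cast
    ring
  · intro i hi
    have : σ i ≠ i := mem_support.1 hi
    simp [permutationMatrix, this]
  · intro i hi
    have : σ i = i := notMem_support.1 hi
    simp [permutationMatrix, this]
  · intro i hi
    have : σ i ≠ i := mem_support.1 hi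
    simp [permutationMatrix, this.symm]
  · intro i hi
    have : σ i = i := notMem_support.1 hi
    simp [permutationMatrix, this]
  · intro τ _ hτ
    have : ∃ i, τ i ≠ i ∧ τ i ≠ σ i := by
      by_contra hcon
      push Not at hcon
      refine hτ ?_
      simpa using eq_one_or_eq_of_isCycle hσ fun i => by
        by_cases hi : τ i = i
        · exact Or.inl hi
        · exact Or.inr (hcon i hi)
    obtain ⟨i, h1, h2⟩ := this
    rw [Finset.prod_eq_zero (Finset.mem_univ i), mul_zero]
    simp [permutationMatrix, h1, h2]

/-- For disjoint `σ` and `τ` one has `(1 + qσ)(1 + qτ) = (1 + q)(1 + qστ)`. Determinants are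
therefore multiplicative up to a power of `1 + q`, which is cancelled. -/
theorem det_one_add_smul_permutationMatrix [IsDomain R] (σ : Perm α) (q : R) (hq : 1 + q ≠ 0) :
    (1 + q • permutationMatrix R σ).det =
      (1 + q) ^ (Fintype.card α - σ.support.card) *
        (σ.cycleType.map fun c => 1 - (-q) ^ c).prod := by
  induction σ using cycle_induction_on with
  | base_one =>
    have : (1 + q • (1 : Matrix α α R)) = (1 + q) • 1 := by rw [add_smul, one_smul]
    simp [permutationMatrix_one, this]
  | base_cycles σ hσ =>
    rw [det_one_add_smul_permutationMatrix_of_isCycle hσ, hσ.cycleType]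
    simp
  | induction_disjoint σ τ hd _ hσ hτ =>
    have hmul : (1 + q • permutationMatrix R σ) * (1 + q • permutationMatrix R τ) =
        (1 + q) • (1 + q • permutationMatrix R (σ * τ)) := by
      have h1 := permutationMatrix_add_of_disjoint (R := R) hd
      calc (1 + q • permutationMatrix R σ) * (1 + q • permutationMatrix R τ)
          = 1 + q • (permutationMatrix R σ + permutationMatrix R τ) +
            (q * q) • (permutationMatrix R σ * permutationMatrix R τ) := by
              rw [add_mul, mul_add, mul_add, one_mul, mul_one, one_mul, smul_mul_smul_comm,
                smul_add]
              abel
        _ = _ := by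
          rw [h1, ← permutationMatrix_mul, add_smul, one_smul, smul_add, smul_add, smul_smul]
          abel
    have hdet := congrArg Matrix.det hmul
    rw [Matrix.det_mul, Matrix.det_smul, hσ, hτ] at hdet
    refine mul_left_cancel₀ (pow_ne_zero (Fintype.card α) hq) (hdet.symm.trans ?_)
    have hle : σ.support.card + τ.support.card ≤ Fintype.card α := by
      rw [← hd.card_support_mul]
      exact Finset.card_le_univ _
    rw [hd.cycleType_mul, hd.card_support_mul, Multiset.map_add, Multiset.prod_add]
    obtain ⟨r, hr⟩ := Nat.exists_eq_add_of_le hle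
    rw [show Fintype.card α - σ.support.card = τ.support.card + r by omega,
      show Fintype.card α - τ.support.card = σ.support.card + r by omega,
      show Fintype.card α - (σ.support.card + τ.support.card) = r by omega, hr]
    ring

theorem det_one_add_smul_permutationMatrix_eq_prod_parts [IsDomain R] (σ : Perm α) (q : R)
    (hq : 1 + q ≠ 0) :
    (1 + q • permutationMatrix R σ).det = (σ.partition.parts.map fun c => 1 - (-q) ^ c).prod := by
  rw [det_one_add_smul_permutationMatrix σ q hq, parts_partition, Multiset.map_add, Multiset.prod_add,
    Multiset.map_replicate, Multiset.prod_replicate]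
  simp [mul_comm]

end PermutationMatrix

end HookCharacter

namespace HookCharacter

open Equiv Equiv.Perm SymmetricGroupCharacter

variable {n k : ℕ}

/-! ### The trace of the hook symmetrizer as a sum of bordered determinants. -/

theorem coeff_cosetSum (b t : Fin k → Fin n) (p : Perm (Fin n)) :
    (cosetSum b t).coeff p = if ⇑p ∘ b = t then 1 else 0 := by
  classical
  rw [cosetSum, MonoidAlgebra.coeff_sum, Finset.sum_apply', Finset.sum_eq_single p]
  · split_ifs <;> simp
  · intro h _ hp
    split_ifs <;> simp [hp]
  · simp

/-- With `x = h ∘ β`, the term of `σ` survives exactly when `x (σ l.succ) = g (x l.succ)` for all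
`l`. This is the Leibniz expansion of a determinant; the column of ones appears because `σ 0` is
unconstrained. -/
theorem sum_coeff_hookElement (β : Fin (k + 1) ↪ Fin n) (g : Perm (Fin n)) :
    ∑ h : Perm (Fin n),
      (MonoidAlgebra.single (g * h) (1 : ℂ) * hookElement β (tail β)).coeff h =
      (n - (k + 1))! * borderedSum (permutationMatrix ℂ g) k := by
  rw [borderedSum, ← nsmul_eq_mul, ← sum_perm_comp β _ fun y hy =>
    det_borderedMatrix_eq_zero _ y hy]
  refine Finset.sum_congr rfl fun h _ => ?_
  rw [single_mul_hookElement, hookElement, antisymmetrizer, Finset.mul_sum,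
    MonoidAlgebra.coeff_sum, Finset.sum_apply', Matrix.det_apply',
    -- Reading off a coefficient after right multiplication inverts `σ`; the reindexing undoes this.
    ← Equiv.sum_comp (Equiv.inv (Perm (Fin (k + 1))))]
  refine Finset.sum_congr rfl fun σ _ => ?_
  have hinv : (σ⁻¹.viaFintypeEmbedding β)⁻¹ = σ.viaFintypeEmbedding β := by
    rw [inv_eq_iff_mul_eq_one, ← viaFintypeEmbedding_mul, inv_mul_cancel]
    exact Equiv.Perm.extendDomain_one _
  rw [Equiv.inv_apply, MonoidAlgebra.coeff_mul_single_apply, coeff_cosetSum, hinv,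
    Equiv.Perm.sign_inv, mul_comm, Fin.prod_univ_succ]
  congr 1
  simp only [borderedMatrix, Matrix.of_apply, Fin.cons_zero, one_mul, Fin.cons_succ,
    permutationMatrix, Function.comp_apply]
  rw [Finset.prod_ite_zero]
  simp only [Finset.prod_const_one]
  refine if_congr ?_ rfl rfl
  rw [funext_iff]
  simp [tail, viaFintypeEmbedding_apply_image]

/-! ### Hook tableaux -/

theorem mem_diagram_hook (k : Fin n) (c : ℕ × ℕ) :
    c ∈ (diagram (hook n k)).cells ↔
      (c.1 = 0 ∧ c.2 < n - k) ∨ (c.1 ≤ k ∧ c.2 = 0) := by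
  have hsort : (hook n k).parts.sort (· ≥ ·) = (n - (k : ℕ)) :: List.replicate k 1 := by
    refine List.Perm.eq_of_pairwise' (Multiset.pairwise_sort _ _) ?_
      (Multiset.coe_eq_coe.1 ?_)
    · rw [List.pairwise_cons]
      refine ⟨fun a ha => ?_, ?_⟩
      · have := k.isLt
        have := List.eq_of_mem_replicate ha
        omega
      · exact List.pairwise_replicate.2 (Or.inr le_rfl)
    · rw [Multiset.sort_eq]
      rw [hook, ← Multiset.cons_coe, Multiset.coe_replicate]
  have hk := k.isLt
  rw [YoungDiagram.mem_cells, diagram, YoungDiagram.mem_ofRowLens]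
  simp only [hsort]
  obtain ⟨i, j⟩ := c
  cases i with
  | zero =>
    simp
    omega
  | succ i => simp

/-- The entries of the first column of a hook tableau. -/
def firstColumn {k : Fin n} (T : Tableau (hook n k)) : Fin ((k : ℕ) + 1) ↪ Fin n where
  toFun l := T.symm ⟨(l, 0), (mem_diagram_hook k _).2 (Or.inr ⟨Nat.lt_succ_iff.1 l.isLt, rfl⟩)⟩
  inj' l l' h := by
    simpa [Fin.ext_iff] using h

theorem apply_firstColumn {k : Fin n} (T : Tableau (hook n k)) (l : Fin ((k : ℕ) + 1)) :
    (T (firstColumn T l)).1 = ((l : ℕ), 0) :=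
  congrArg Subtype.val (T.apply_symm_apply _)

theorem mem_range_firstColumn {k : Fin n} (T : Tableau (hook n k)) (i : Fin n) :
    i ∈ Set.range (firstColumn T) ↔ (T i).1.2 = 0 := by
  constructor
  · rintro ⟨l, rfl⟩
    rw [apply_firstColumn]
  · intro hi
    have hmem := (mem_diagram_hook k _).1 (T i).2
    refine ⟨⟨(T i).1.1, by omega⟩, ?_⟩
    apply T.injective
    apply Subtype.ext
    rw [apply_firstColumn]
    exact Prod.ext rfl hi.symm

/-- Every row below the first is a single cell, so its symbol is fixed, and the symbols of the first
row are then permuted freely. -/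
theorem mem_rowGroup_hook {k : Fin n} (T : Tableau (hook n k)) (p : Perm (Fin n)) :
    p ∈ rowGroup T ↔ ⇑p ∘ tail (firstColumn T) = tail (firstColumn T) := by
  have hT : ∀ l : Fin k, (T (firstColumn T l.succ)).1 = ((l : ℕ) + 1, 0) := fun l =>
    apply_firstColumn T l.succ
  have hrow : ∀ i, (T i).1.1 ≠ 0 → ∃ l : Fin k, firstColumn T l.succ = i := by
    intro i hi
    have hmem := (mem_diagram_hook k _).1 (T i).2
    obtain ⟨l, hl⟩ := (mem_range_firstColumn T i).2 (by omega)
    have hl0 : l ≠ 0 := by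
      rintro rfl
      apply hi
      rw [← hl]
      rw [apply_firstColumn]
      rfl
    obtain ⟨l, rfl⟩ := Fin.exists_succ_eq.2 hl0
    exact ⟨l, hl⟩
  simp only [rowGroup, Finset.mem_filter, Finset.mem_univ, true_and]
  constructor
  · intro h
    funext l
    have h1 : (T (p (firstColumn T l.succ))).1.1 = (l : ℕ) + 1 := by
      rw [h, hT]
    obtain ⟨l', hl'⟩ := hrow (p (firstColumn T l.succ)) (by omega)
    have h2 := hT l'
    rw [hl'] at h2
    rw [h2] at h1
    have : l' = l := Fin.ext (by simpa using h1)
    rw [Function.comp_apply, tail, ← hl', this]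
  · intro h i
    by_cases hi : (T i).1.1 = 0
    · by_contra hne
      obtain ⟨l, hl⟩ := hrow (p i) (by rwa [← hi])
      have h1 : p (firstColumn T l.succ) = firstColumn T l.succ := congrFun h l
      have h2 : i = firstColumn T l.succ := p.injective (by rw [h1, hl])
      apply hne
      rw [h2, h1]
    · obtain ⟨l, rfl⟩ := hrow i hi
      have h1 : p (firstColumn T l.succ) = firstColumn T l.succ := congrFun h l
      rw [h1]

theorem mem_colGroup_hook {k : Fin n} (T : Tableau (hook n k)) (q : Perm (Fin n)) :
    q ∈ colGroup T ↔ ∀ i, i ∉ Set.range (firstColumn T) → q i = i := by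
  have hcol : ∀ i j, (T i).1.2 = (T j).1.2 → (T j).1.2 ≠ 0 → i = j := by
    intro i j hij hj
    have hi := (mem_diagram_hook k _).1 (T i).2
    have hj' := (mem_diagram_hook k _).1 (T j).2
    exact T.injective (Subtype.ext (Prod.ext (by omega) hij))
  simp only [colGroup, Finset.mem_filter, Finset.mem_univ, true_and, mem_range_firstColumn]
  constructor
  · exact fun h i hi => hcol _ _ (h i) hi
  · intro h i
    by_cases hi : (T i).1.2 = 0
    · by_contra hne
      have h1 : q (q i) = q i := h (q i) (by rwa [← hi])
      exact hne (by rw [q.injective h1])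
    · rw [h i hi]

theorem sum_colGroup_hook {k : Fin n} (T : Tableau (hook n k)) :
    ∑ q ∈ colGroup T, MonoidAlgebra.single q (((sign q : ℤ) : ℂ)) =
      antisymmetrizer (firstColumn T) := by
  classical
  symm
  refine Finset.sum_bij (fun σ _ => σ.viaFintypeEmbedding (firstColumn T)) ?_ ?_ ?_ ?_
  · intro σ _
    exact (mem_colGroup_hook T _).2 fun i hi => viaFintypeEmbedding_apply_notMem_range _ _ hi
  · intro σ _ τ _ h
    exact Equiv.Perm.extendDomainHom_injective _ h
  · intro q hq
    rw [mem_colGroup_hook] at hq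
    have hq' : ∀ i, i ∈ Set.range (firstColumn T) ↔ q i ∈ Set.range (firstColumn T) := by
      intro i
      constructor
      · intro hi
        by_contra hne
        have h := q.injective (hq _ hne)
        exact hne (h.symm ▸ hi)
      · intro hi
        by_contra hne
        rw [hq i hne] at hi
        exact hne hi
    refine ⟨(Equiv.ofInjective _ (firstColumn T).injective).symm.permCongr
      (q.subtypePerm fun i => (hq' i).symm), Finset.mem_univ _, ?_⟩
    ext i
    by_cases hi : i ∈ Set.range (firstColumn T)
    · obtain ⟨l, rfl⟩ := hi
      rw [viaFintypeEmbedding_apply_image]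
      congr 1
      simp [Equiv.permCongr_apply, Equiv.apply_ofInjective_symm]
    · rw [viaFintypeEmbedding_apply_notMem_range _ _ hi, hq i hi]
  · intro σ _
    rw [viaFintypeEmbedding_sign]

theorem youngSymmetrizer_hook {k : Fin n} (T : Tableau (hook n k)) :
    youngSymmetrizer T = hookElement (firstColumn T) (tail (firstColumn T)) := by
  rw [youngSymmetrizer, sum_colGroup_hook, hookElement, cosetSum, ← Finset.sum_filter]
  congr 2
  ext p
  simp [mem_rowGroup_hook]

/-- Hook characters are normalized sums of bordered determinants. -/
theorem irrCharacter_hook (k : Fin n) (g : Perm (Fin n)) :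
    (n * (k : ℕ)! : ℂ) * irrCharacter (hook n k) g =
      borderedSum (permutationMatrix ℂ g) k := by
  obtain ⟨T⟩ := nonempty_tableau (hook n k)
  -- The factor `(n - (k + 1))!` of `α` also appears in the trace and cancels at the end.
  have h := smul_trace_span_singleton (youngSymmetrizer T) ((n - ((k : ℕ) + 1))! * (n * (k : ℕ)!))
    (by rw [youngSymmetrizer_hook, hookElement_mul_self]) g (spechtRep T g)
    (spechtRep_apply T g)
  simp only [youngSymmetrizer_hook T] at h
  rw [sum_coeff_hookElement, mul_assoc] at h
  rw [irrCharacter_eq T]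
  exact mul_left_cancel₀ (Nat.cast_ne_zero.2 (Nat.factorial_ne_zero _)) h

end HookCharacter

namespace HookCharacter

open Equiv Equiv.Perm SymmetricGroupCharacter Polynomial

/-! ### Weighted coefficient sums of polynomials divisible by a power of `1 - X` -/

/-- The linear functional on polynomials that sends `X ^ k` to `f k`. -/
def coeffSum (f : ℂ → ℂ) : ℂ[X] →ₗ[ℂ] ℂ :=
  Polynomial.lsum fun k => f k • LinearMap.id

theorem coeffSum_monomial (f : ℂ → ℂ) (k : ℕ) (a : ℂ) :
    coeffSum f (monomial k a) = f k * a := by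
  simp [coeffSum, Polynomial.sum_monomial_index]

/-- On `X ^ k` the left side is `f k - f (k + 1)`. -/
theorem coeffSum_one_sub_X_mul (f : ℂ → ℂ) (p : ℂ[X]) :
    coeffSum f ((1 - X) * p) = -coeffSum (fwdDiff 1 f) p := by
  induction p using Polynomial.induction_on' with
  | add p q hp hq => rw [mul_add, map_add, map_add, hp, hq, neg_add]
  | monomial k a =>
    rw [sub_mul, one_mul, X_mul_monomial, map_sub, coeffSum_monomial, coeffSum_monomial,
      coeffSum_monomial, fwdDiff]
    push_cast
    ring

theorem coeffSum_one_sub_X_pow_mul (m : ℕ) (f : ℂ → ℂ) (p : ℂ[X]) :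
    coeffSum f ((1 - X) ^ m * p) = (-1) ^ m * coeffSum ((fwdDiff 1)^[m] f) p := by
  induction m generalizing f with
  | zero => simp
  | succ m ih =>
    rw [pow_succ', mul_assoc, coeffSum_one_sub_X_mul, ih, Function.iterate_succ_apply, pow_succ']
    ring

theorem coeffSum_const (c : ℂ) (p : ℂ[X]) : coeffSum (fun _ => c) p = c * p.eval 1 := by
  induction p using Polynomial.induction_on' with
  | add p q hp hq => rw [map_add, hp, hq, eval_add, mul_add]
  | monomial k a => simp [coeffSum_monomial]

theorem fwdDiff_iter_sub_two_mul_pow {j m : ℕ} (hj : j ≤ m) (a : ℂ) :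
    (fwdDiff (1 : ℂ))^[m] (fun x : ℂ => (a - 2 * x) ^ j) =
      fun _ => if j = m then (-2) ^ m * (m ! : ℂ) else 0 := by
  set q : ℂ[X] := (C (-2) * X + C a) ^ j with hq
  have hev : (fun x : ℂ => (a - 2 * x) ^ j) = q.eval := by
    funext x
    simp only [hq, eval_pow, eval_add, eval_mul, eval_C, eval_X]
    ring
  have hdeg : q.natDegree = j := by
    rw [hq, natDegree_pow, natDegree_linear (by norm_num), mul_one]
  have hlead : q.leadingCoeff = (-2) ^ j := by
    rw [hq, leadingCoeff_pow, leadingCoeff_linear (by norm_num)]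
  rw [hev]
  rcases hj.lt_or_eq with h | rfl
  · rw [fwdDiff_iter_eq_zero_of_degree_lt (by omega)]
    funext x
    simp [h.ne]
  · have := fwdDiff_iter_degree_eq_factorial q
    rw [hdeg, hlead] at this
    rw [this]
    funext x
    simp

theorem prod_one_sub_X_pow (s : Multiset ℕ) :
    (s.map fun c => (1 - X ^ c : ℂ[X])).prod =
      (1 - X) ^ s.card * (s.map fun c => ∑ i ∈ Finset.range c, (X ^ i : ℂ[X])).prod := by
  induction s using Multiset.induction with
  | empty => simp
  | cons c s ih =>
    rw [Multiset.map_cons, Multiset.prod_cons, ih, Multiset.map_cons, Multiset.prod_cons,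
      Multiset.card_cons, ← mul_neg_geom_sum]
    ring

theorem eval_one_prod_geom_sum (s : Multiset ℕ) :
    (s.map fun c => ∑ i ∈ Finset.range c, (X ^ i : ℂ[X])).prod.eval 1 = (s.prod : ℂ) := by
  induction s using Multiset.induction with
  | empty => simp
  | cons c s ih => simp [ih, eval_finsetSum]

/-! ### The generating polynomial of the hook characters -/

/-- The bordered recursion says that consecutive hook characters add up to coefficients of `det (1 +
X P_g)`, that is, `(1 + X) * P = E`; substituting `-X` introduces the alternating signs. -/
theorem one_sub_X_mul_sum_hook {n : ℕ} (hn : n ≠ 0) (g : Perm (Fin n)) :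
    (1 - X) * ∑ k : Fin n, monomial (k : ℕ) ((-1) ^ (k : ℕ) * irrCharacter (hook n k) g) =
      (g.partition.parts.map fun c => (1 - X ^ c : ℂ[X])).prod := by
  set a := permutationMatrix ℂ g with ha
  set E : ℂ[X] := (1 + (X : ℂ[X]) • a.map C).det with hE
  set r : ℕ → ℂ := fun k => borderedSum a k / (n * k !) with hr
  have hn' : (n : ℂ) ≠ 0 := Nat.cast_ne_zero.2 hn
  -- Tuples longer than `n` repeat an entry, so `r` extends the hook characters by zero and the
  -- recursion needs no boundary case.
  have hr_zero : ∀ k, n ≤ k → r k = 0 := fun k hk => by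
    simp [hr, borderedSum_eq_zero a hk]
  have hr_hook : ∀ k : Fin n, irrCharacter (hook n k) g = r k := fun k => by
    have := irrCharacter_hook k g
    rw [hr, eq_div_iff (mul_ne_zero hn' (Nat.cast_ne_zero.2 (Nat.factorial_ne_zero _))),
      mul_comm, this]
  have hE_zero : E.coeff 0 = r 0 := by
    have := sum_det_submatrix a 0
    simp [← hE] at this
    simp [hr, borderedSum_zero, ← this, hn']
  have hE_succ : ∀ k, E.coeff (k + 1) = r (k + 1) + r k := fun k => by
    have h1 := borderedSum_succ (k := k) a (sum_permutationMatrix g)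
    rw [sum_det_submatrix, ← hE] at h1
    have h2 : ((k ! : ℕ) : ℂ) ≠ 0 := Nat.cast_ne_zero.2 (Nat.factorial_ne_zero _)
    have h3 : (k + 1 : ℂ) ≠ 0 := Nat.cast_add_one_ne_zero k
    simp only [hr, Nat.factorial_succ] at h1 ⊢
    push_cast at h1 ⊢
    field_simp
    linear_combination -h1
  set P : ℂ[X] := ∑ k : Fin n, monomial (k : ℕ) (irrCharacter (hook n k) g) with hP
  have hP_coeff : ∀ k, P.coeff k = r k := fun k => by
    rw [hP, finsetSum_coeff]
    simp only [coeff_monomial, hr_hook]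
    by_cases hk : k < n
    · rw [Finset.sum_eq_single ⟨k, hk⟩]
      · simp
      · intro b _ hb
        exact if_neg fun h => hb (Fin.ext h)
      · simp
    · rw [hr_zero k (by omega)]
      exact Finset.sum_eq_zero fun b _ => if_neg fun h : (b : ℕ) = k => hk (h ▸ b.isLt)
  have hPE : (1 + X) * P = E := by
    ext k
    cases k with
    | zero => simp [hP_coeff, hE_zero, add_mul]
    | succ k => simp [hP_coeff, hE_succ, add_mul]
  have hX : (1 + X : ℂ[X]) ≠ 0 := by
    rw [add_comm]
    exact X_add_C_ne_zero 1
  have hE_prod : E = (g.partition.parts.map fun c => 1 - (-X : ℂ[X]) ^ c).prod := by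
    rw [← det_one_add_smul_permutationMatrix_eq_prod_parts g X hX, hE]
    congr 3
    ext i j : 2
    simp [ha, permutationMatrix, apply_ite]
  have hcomp := congrArg (fun p : ℂ[X] => p.comp (-X)) (hPE.trans hE_prod)
  simp only [mul_comp, add_comp, one_comp, X_comp, multiset_prod_comp, Multiset.map_map,
    Function.comp_def, sub_comp, pow_comp, neg_comp, neg_neg, ← sub_eq_add_neg] at hcomp
  rw [← hcomp]
  congr 1
  rw [hP, Polynomial.sum_comp]
  refine Finset.sum_congr rfl fun k _ => ?_
  rw [monomial_comp, neg_pow, ← C_mul_X_pow_eq_monomial]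
  simp
  ring

theorem sum_hook_eq_one_sub_X_pow_mul {n : ℕ} (g : Perm (Fin n)) {m : ℕ}
    (hm : g.partition.parts.card = m + 1) :
    ∑ k : Fin n, monomial (k : ℕ) ((-1) ^ (k : ℕ) * irrCharacter (hook n k) g) =
      (1 - X) ^ m * (g.partition.parts.map fun c => ∑ i ∈ Finset.range c, (X ^ i : ℂ[X])).prod := by
  -- For `n = 0` the previous identity would read `0 = 1`; the existence of a part excludes this
  -- case.
  have hn : n ≠ 0 := by
    rintro rfl
    have := g.partition.parts_sum
    obtain ⟨c, hc⟩ := Multiset.card_pos_iff_exists_mem.1 (by omega : 0 < g.partition.parts.card)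
    have h1 := g.partition.parts_pos hc
    have h2 := Multiset.single_le_sum (fun _ _ => Nat.zero_le _) c hc
    have h3 := Fintype.card_fin 0
    omega
  have hX : (1 - X : ℂ[X]) ≠ 0 := by
    rw [← neg_sub]
    exact neg_ne_zero.2 (X_sub_C_ne_zero 1)
  apply mul_left_cancel₀ hX
  rw [one_sub_X_mul_sum_hook hn, prod_one_sub_X_pow, hm, pow_succ', mul_assoc]

end HookCharacter

end

theorem lemma4p5 (n : ℕ) (π : n.Partition) (j : ℕ) (hj : j + 1 ≤ π.parts.card) :
    ∑ k : Fin n, (-1 : ℂ) ^ (k : ℕ) *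
        SymmetricGroupCharacter.chi (SymmetricGroupCharacter.hook n k) π *
        ((n : ℂ) - 2 * ((k : ℕ) : ℂ) - 1) ^ j =
      if j + 1 = π.parts.card then
        (2 : ℂ) ^ (π.parts.card - 1) * ((π.parts.card - 1)! : ℂ) * (π.parts.prod : ℂ)
      else 0 := by
  obtain ⟨g, hg⟩ := SymmetricGroupCharacter.exists_hasCycleType π
  obtain ⟨m, hm⟩ : ∃ m, π.parts.card = m + 1 := ⟨π.parts.card - 1, by omega⟩
  have hg' : g.partition.parts = π.parts := hg
  have h := congrArg (HookCharacter.coeffSum fun x : ℂ => ((n - 1 : ℂ) - 2 * x) ^ j)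
    (HookCharacter.sum_hook_eq_one_sub_X_pow_mul g (hg' ▸ hm))
  rw [HookCharacter.coeffSum_one_sub_X_pow_mul,
    HookCharacter.fwdDiff_iter_sub_two_mul_pow (by omega : j ≤ m), HookCharacter.coeffSum_const,
    HookCharacter.eval_one_prod_geom_sum, hg', map_sum] at h
  calc _ = ∑ k : Fin n, HookCharacter.coeffSum (fun x : ℂ => ((n - 1 : ℂ) - 2 * x) ^ j)
        (Polynomial.monomial (k : ℕ) ((-1) ^ (k : ℕ) *
          SymmetricGroupCharacter.irrCharacter (SymmetricGroupCharacter.hook n k) g)) := by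
        refine Finset.sum_congr rfl fun k _ => ?_
        rw [HookCharacter.coeffSum_monomial, SymmetricGroupCharacter.chi_eq _ π g hg]
        ring
    _ = _ := by
        rw [h, hm]
        by_cases hjm : j = m
        -- The sign `(-1) ^ m` from the differences and the leading coefficient `(-2) ^ m` combine
        -- to `2 ^ m`.
        · rw [if_pos hjm, if_pos (by omega), Nat.add_sub_cancel, ← mul_assoc, ← mul_assoc,
            ← mul_pow]
          norm_num
        · rw [if_neg hjm, if_neg (by omega)]
          ring
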